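/- Let $\mathcal X$ be a finite alphabet and $P_X$ a pmf on $\mathcal X$; logarithms are in base 2. Let $d(y^n,z^n)=\sum_{i=1}^n \rho(y_i,z_i)$ be an additive distortion measure with $\rho\ge 0$ and $\rho(a,a)=0$ for every $a\in\mathcal X$. Let $D\ge 0$, $\lambda>0$ and $0<c<\infty$. For $n\ge 1$ let $\mathcal P_n$ be the set of types (empirical pmfs) $P_{x^n}$ of sequences $x^n\in\mathcal X^n$, let $T(P)\subseteq\mathcal X^n$ be the set of sequences of type $P\in\mathcal P_n$, let $\mathcal D(P\|Q)$ be the Kullback-Leibler divergence (with values in $[0,\infty]$), and let $h_c(P,Q)=\mathcal D(P\|U)+c\,\mathcal D(Q\|U)$ with $U=\frac{1}{1+c}P+\frac{c}{1+c}Q$. Put $$\Lambda^{*,n}_{ks}(P_X)=\Big\{P\in\mathcal P_n:\ \mathcal D(P\|P_X)<\lambda-|\mathcal X|\tfrac{\log(n+1)}{n}\Big\},\qquad \Lambda^{*,n}_{tr}(P_X)=\Big\{P\in\mathcal P_n:\ h_c(P,P_X)<\lambda-|\mathcal X|\tfrac{\log[(n+1)(cn+1)]}{n}\Big\},$$ let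 $\Gamma^n_{ks}(P_X)$ (respectively $\Gamma^n_{tr,c}(P_X)$) be the set of all $P\in\mathcal P_n$ such that for every $y^n\in T(P)$ there is $z^n\in\mathcal X^n$ with $d(y^n,z^n)\le nD$ and $P_{z^n}\in\Lambda^{*,n}_{ks}(P_X)$ (respectively $P_{z^n}\in\Lambda^{*,n}_{tr}(P_X)$), and define the indistinguishability regions of the known-source game and of the game with training data $$\Gamma^\infty_{ks}(P_X)=\mathrm{cl}\Big(\bigcup_{n\ge1}\Gamma^n_{ks}(P_X)\Big),\qquad \Gamma^\infty_{tr,c}(P_X)=\mathrm{cl}\Big(\bigcup_{n\ge1}\Gamma^n_{tr,c}(P_X)\Big).$$ Then $\Gamma^\infty_{ks}(P_X)\subseteq\Gamma^\infty_{tr,c}(P_X)$, and the inclusion is strict, $\Gamma^\infty_{ks}(P_X)\subsetneq\Gamma^\infty_{tr,c}(P_X)$, unless $\Gamma^\infty_{ks}(P_X)$ is already the set of all pmfs on $\mathcal X$. -/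

import Mathlib

namespace HypTest

/-- The empirical pmf (type) of a sequence `x` of length `n` over `X`. -/
noncomputable def empirical {X : Type*} [DecidableEq X] {n : ℕ} (x : Fin n → X) : X → ℝ :=
  fun a => ((Finset.univ.filter (fun i => x i = a)).card : ℝ) / (n : ℝ)

/-- The set `𝒫ₙ` of types with denominator `n`. -/
def types (X : Type*) [DecidableEq X] (n : ℕ) : Set (X → ℝ) :=
  Set.range (fun x : Fin n → X => empirical x)

/-- The type class `T(P)`: all sequences of length `n` whose type is `P`. -/
def typeClass {X : Type*} [DecidableEq X] (n : ℕ) (P : X → ℝ) : Set (Fin n → X) :=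
  {x | empirical x = P}

open Classical in
/-- The Kullback-Leibler divergence `D(P‖Q) = ∑ₐ P(a) log₂ (P(a) / Q(a))` of two pmfs on a finite
alphabet, with `0 log 0 = 0` and `p log (p / 0) = ∞` for `p > 0`. -/
noncomputable def kl {X : Type*} [Fintype X] (P Q : X → ℝ) : EReal :=
  if ∀ a, Q a = 0 → P a = 0 then
    ((∑ a, P a * Real.logb 2 (P a / Q a) : ℝ) : EReal)
  else ⊤

/-- The mixture `U = P / (1 + c) + c Q / (1 + c)`. -/
noncomputable def mix {X : Type*} (c : ℝ) (P Q : X → ℝ) : X → ℝ :=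
  fun a => 1 / (1 + c) * P a + c / (1 + c) * Q a

/-- The generalized log-likelihood ratio `h_c(P, Q) = D(P‖U) + c D(Q‖U)`. -/
noncomputable def hc {X : Type*} [Fintype X] (c : ℝ) (P Q : X → ℝ) : EReal :=
  kl P (mix c P Q) + (c : EReal) * kl Q (mix c P Q)

/-- The additive distortion between two sequences, for the per-letter distortion `ρ`. -/
def dist {X : Type*} (ρ : X → X → ℝ) {n : ℕ} (y z : Fin n → X) : ℝ :=
  ∑ i, ρ (y i) (z i)

/-- The defender's optimum acceptance region `Λ*_ks` (a set of types with denominator `n`) when the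
source `PX` is known and the false positive error exponent is `lam`. -/
noncomputable def acceptKS {X : Type*} [Fintype X] [DecidableEq X] (lam : ℝ) (n : ℕ)
    (PX : X → ℝ) : Set (X → ℝ) :=
  {P | P ∈ types X n ∧
    kl P PX < ((lam - (Fintype.card X : ℝ) * (Real.logb 2 ((n : ℝ) + 1) / (n : ℝ)) : ℝ) : EReal)}

/-- The set `Γⁿ_ks(PX)` of the types all of whose sequences can be moved into `Λ*_ks` with
per-letter distortion at most `D`. -/
noncomputable def gammaKS {X : Type*} [Fintype X] [DecidableEq X] (ρ : X → X → ℝ) (D lam : ℝ)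
    (n : ℕ) (PX : X → ℝ) : Set (X → ℝ) :=
  {P | P ∈ types X n ∧ ∀ y ∈ typeClass n P, ∃ z : Fin n → X,
    empirical z ∈ acceptKS lam n PX ∧ dist ρ y z ≤ (n : ℝ) * D}

/-- The indistinguishability region `Γ^∞_ks(PX)`: the closure of the union of the `Γⁿ_ks(PX)` over
all sequence lengths `n ≥ 1`. -/
noncomputable def gammaKSInf {X : Type*} [Fintype X] [DecidableEq X] (ρ : X → X → ℝ) (D lam : ℝ)
    (PX : X → ℝ) : Set (X → ℝ) :=
  closure (⋃ (n : ℕ) (_ : 1 ≤ n), gammaKS ρ D lam n PX)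

/-- The defender's optimum acceptance region `Λ*_tr` for a test sequence of length `n` and a
training sequence of length `N = c n`, extended to arbitrary pairs `(P, Q)` of pmfs. -/
noncomputable def acceptTR {X : Type*} [Fintype X] (c lam : ℝ) (n : ℕ) :
    Set ((X → ℝ) × (X → ℝ)) :=
  {PQ | hc c PQ.1 PQ.2 <
    ((lam - (Fintype.card X : ℝ) *
      (Real.logb 2 (((n : ℝ) + 1) * (c * (n : ℝ) + 1)) / (n : ℝ)) : ℝ) : EReal)}

/-- The section `Λ*ⁿ_tr(Q)`: the types `P` with denominator `n` such that `(P, Q) ∈ Λ*ⁿ_tr`. -/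
noncomputable def acceptTRSection {X : Type*} [Fintype X] [DecidableEq X] (c lam : ℝ) (n : ℕ)
    (Q : X → ℝ) : Set (X → ℝ) :=
  {P | P ∈ types X n ∧ (P, Q) ∈ acceptTR c lam n}

/-- The set `Γⁿ_{tr,c}(Q)` of the types all of whose sequences can be moved into `Λ*ⁿ_tr(Q)` with
per-letter distortion at most `D`. -/
noncomputable def gammaTR {X : Type*} [Fintype X] [DecidableEq X] (ρ : X → X → ℝ) (D c lam : ℝ)
    (n : ℕ) (Q : X → ℝ) : Set (X → ℝ) :=
  {P | P ∈ types X n ∧ ∀ y ∈ typeClass n P, ∃ z : Fin n → X,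
    empirical z ∈ acceptTRSection c lam n Q ∧ dist ρ y z ≤ (n : ℝ) * D}

/-- The indistinguishability region `Γ^∞_{tr,c}(Q)`: the closure of the union of the `Γⁿ_{tr,c}(Q)`
over all sequence lengths `n ≥ 1`. -/
noncomputable def gammaTRInf {X : Type*} [Fintype X] [DecidableEq X] (ρ : X → X → ℝ)
    (D c lam : ℝ) (Q : X → ℝ) : Set (X → ℝ) :=
  closure (⋃ (n : ℕ) (_ : 1 ≤ n), gammaTR ρ D c lam n Q)

end HypTest

/-! With `U` the mixture, D(P‖Q) − h_c(P, Q) = (1 + c) D(U‖Q), so D(P‖Q) ≤ λ forces h_c(P, Q) < λ: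
either P = Q and h_c = 0 < λ, or the gap is positive (`hcReal_lt_of_kl_le`). A closed condition thus
lies inside an open one. Repeating sequences makes the rate penalty vanish, so types movable into
{h_c < λ} belong to the training-data region (`movable_subset_iUnion_gammaTR`), which gives the
inclusion.

For strictness, suppose the regions coincide. Compactness of couplings shows that every point of the
known-source region is moved by some coupling into {D ≤ λ}, hence into the open set {h_c < λ}
(`closure_movable_subset`). The pmfs movable into an open set form a relatively open set
(`fstMarginal_image_couplings_mem_nhdsWithin`) contained in the training-data region
(`fstMarginal_mem_closure_movable`). The common region is then clopen in the connected simplex and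
contains `PX`, so it is the whole simplex. -/

open Filter Topology

namespace HypTest

/-! ### Comparison of h_c with the divergence, and the rate penalty. -/

section Information

/-- The generalized log-likelihood ratio as a real number, written so that continuity is
visible. -/
noncomputable def hcReal {X : Type*} [Fintype X] (c : ℝ) (P Q : X → ℝ) : ℝ :=
  ∑ a, (P a * Real.log (P a) + c * (Q a * Real.log (Q a)) -
    (1 + c) * (mix c P Q a * Real.log (mix c P Q a))) / Real.log 2

variable {X : Type*} [Fintype X]

theorem continuous_hcReal (c : ℝ) (Q : X → ℝ) : Continuous fun P => hcReal c P Q := by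
  unfold hcReal mix
  refine continuous_finsetSum _ fun a _ => ?_
  refine Continuous.div_const ?_ _
  have h1 : Continuous fun P : X → ℝ => P a * Real.log (P a) :=
    Real.continuous_mul_log.comp (continuous_apply a)
  have h2 : Continuous fun P : X → ℝ => (1 / (1 + c) * P a + c / (1 + c) * Q a) *
      Real.log (1 / (1 + c) * P a + c / (1 + c) * Q a) :=
    Real.continuous_mul_log.comp (by fun_prop)
  exact (h1.add continuous_const).sub (continuous_const.mul h2)

theorem one_add_mul_mix {X : Type*} {c : ℝ} (hc : 0 < c) (P Q : X → ℝ) (a : X) :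
    (1 + c) * mix c P Q a = P a + c * Q a := by
  unfold mix
  field_simp

theorem mix_eq_zero {X : Type*} {c : ℝ} (hc : 0 < c) {P Q : X → ℝ} {a : X} (hP : 0 ≤ P a) (hQ : 0 ≤ Q a)
    (h : mix c P Q a = 0) : P a = 0 ∧ Q a = 0 := by
  have h1 := one_add_mul_mix hc P Q a
  rw [h, mul_zero] at h1
  have h2 := mul_nonneg hc.le hQ
  have h3 : c * Q a = 0 := by linarith
  exact ⟨by linarith, (mul_eq_zero.1 h3).resolve_left hc.ne'⟩

theorem mul_logb_div (b p u : ℝ) (h : u = 0 → p = 0) :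
    p * Real.logb b (p / u) = (p * Real.log p - p * Real.log u) / Real.log b := by
  rcases eq_or_ne p 0 with rfl | hp
  · simp
  · have hu : u ≠ 0 := fun hu => hp (h hu)
    rw [Real.logb, Real.log_div hp hu]
    ring

/-- The mixture vanishes only where both arguments do, so neither divergence is infinite; the
log-mixture terms merge through P + cQ = (1 + c)U. -/
theorem hc_eq_coe_hcReal {c : ℝ} (hc : 0 < c) {P Q : X → ℝ} (hP : ∀ a, 0 ≤ P a)
    (hQ : ∀ a, 0 ≤ Q a) : HypTest.hc c P Q = (hcReal c P Q : EReal) := by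
  have h0 := fun a h => mix_eq_zero hc (hP a) (hQ a) h
  rw [HypTest.hc, kl, kl, if_pos fun a h => (h0 a h).1, if_pos fun a h => (h0 a h).2]
  rw [← EReal.coe_mul, ← EReal.coe_add, EReal.coe_eq_coe_iff, hcReal, Finset.mul_sum,
    ← Finset.sum_add_distrib]
  refine Finset.sum_congr rfl fun a _ => ?_
  rw [mul_logb_div _ _ _ fun h => (h0 a h).1, mul_logb_div _ _ _ fun h => (h0 a h).2,
    ← mul_assoc (1 + c), one_add_mul_mix hc]
  ring

theorem sub_le_mul_log_sub {u q : ℝ} (hu : 0 ≤ u) (hq : 0 < q) :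
    u - q ≤ u * Real.log u - u * Real.log q := by
  rcases hu.eq_or_lt with rfl | hu
  · simpa using hq.le
  · have h := Real.log_le_sub_one_of_pos (div_pos hq hu)
    rw [Real.log_div hq.ne' hu.ne'] at h
    have h2 := mul_le_mul_of_nonneg_left h hu.le
    rw [mul_sub, mul_sub, mul_div_cancel₀ _ hu.ne'] at h2
    linarith

theorem sub_lt_mul_log_sub {u q : ℝ} (hu : 0 ≤ u) (hq : 0 < q) (hne : u ≠ q) :
    u - q < u * Real.log u - u * Real.log q := by
  rcases hu.eq_or_lt with rfl | hu
  · simpa using hq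
  · have h := Real.log_lt_sub_one_of_pos (div_pos hq hu)
      (fun h => hne ((div_eq_one_iff_eq hu.ne').1 h).symm)
    rw [Real.log_div hq.ne' hu.ne'] at h
    have h2 := mul_lt_mul_of_pos_left h hu
    rw [mul_sub, mul_sub, mul_div_cancel₀ _ hu.ne'] at h2
    linarith

/-- Since p − q = (1 + c)(u − q), for q > 0 the gap is (1 + c)(u log u − u log q − (u − q)), which
is nonnegative and vanishes only at u = q. The correction p − q makes the bound hold letter by
letter and sums to zero over pmfs. -/
theorem hc_summand_le {c p q : ℝ} (hc : 0 < c) (hp : 0 ≤ p) (hq : 0 ≤ q) (h0 : q = 0 → p = 0)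
    {u : ℝ} (hu : (1 + c) * u = p + c * q) :
    p * Real.log p + c * (q * Real.log q) - (1 + c) * (u * Real.log u) + (p - q) ≤
        p * Real.log p - p * Real.log q ∧
      (p ≠ q → p * Real.log p + c * (q * Real.log q) - (1 + c) * (u * Real.log u) + (p - q) <
        p * Real.log p - p * Real.log q) := by
  rcases hq.eq_or_lt with rfl | hq
  · obtain rfl := h0 rfl
    have : u = 0 := by
      have h1 : (1 + c) * u = 0 := by linarith
      exact (mul_eq_zero.1 h1).resolve_left (by positivity)
    simp [this]
  · have hc1 : 0 < 1 + c := by positivity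
    have hu0 : 0 ≤ u := by
      refine nonneg_of_mul_nonneg_right (a := 1 + c) ?_ hc1
      rw [hu]; positivity
    have key : (1 + c) * (u * Real.log q) = p * Real.log q + c * (q * Real.log q) := by
      rw [← mul_assoc, hu]; ring
    constructor
    · have := mul_le_mul_of_nonneg_left (sub_le_mul_log_sub hu0 hq) hc1.le
      rw [mul_sub, mul_sub, hu] at this
      linarith
    · intro hne
      have hne' : u ≠ q := by
        rintro rfl
        exact hne (by linarith)
      have := mul_lt_mul_of_pos_left (sub_lt_mul_log_sub hu0 hq hne') hc1
      rw [mul_sub, mul_sub, hu] at this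
      linarith

/-- For pmfs with `P ≪ Q`, `h_c(P, Q) ≤ D(P‖Q)`, with equality only for `P = Q`. -/
theorem hcReal_le_kl {c : ℝ} (hc : 0 < c) {P Q : X → ℝ} (hP : P ∈ stdSimplex ℝ X)
    (hQ : Q ∈ stdSimplex ℝ X) (h0 : ∀ a, Q a = 0 → P a = 0) :
    hcReal c P Q ≤ ∑ a, P a * Real.logb 2 (P a / Q a) ∧
      (P ≠ Q → hcReal c P Q < ∑ a, P a * Real.logb 2 (P a / Q a)) := by
  have hl : 0 < Real.log 2 := Real.log_pos one_lt_two
  have hs : ∑ a, (P a - Q a) / Real.log 2 = 0 := by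
    rw [← Finset.sum_div, Finset.sum_sub_distrib, hP.2, hQ.2]; simp
  have hk := fun a => hc_summand_le hc (hP.1 a) (hQ.1 a) (h0 a) (one_add_mul_mix hc P Q a)
  have e1 : hcReal c P Q = ∑ a, (P a * Real.log (P a) + c * (Q a * Real.log (Q a)) -
      (1 + c) * (mix c P Q a * Real.log (mix c P Q a)) + (P a - Q a)) / Real.log 2 := by
    simp only [add_div _ (P _ - Q _)]
    rw [Finset.sum_add_distrib, hs, add_zero, hcReal]
  have e2 : ∑ a, P a * Real.logb 2 (P a / Q a) =
      ∑ a, (P a * Real.log (P a) - P a * Real.log (Q a)) / Real.log 2 :=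
    Finset.sum_congr rfl fun a _ => mul_logb_div _ _ _ (h0 a)
  rw [e1, e2]
  constructor
  · exact Finset.sum_le_sum fun a _ => div_le_div_of_nonneg_right (hk a).1 hl.le
  · intro hne
    obtain ⟨a, ha⟩ := Function.ne_iff.1 hne
    exact Finset.sum_lt_sum (fun a _ => div_le_div_of_nonneg_right (hk a).1 hl.le)
      ⟨a, Finset.mem_univ a, div_lt_div_of_pos_right ((hk a).2 ha) hl⟩

theorem kl_le_coe_iff {P Q : X → ℝ} {r : ℝ} : kl P Q ≤ (r : EReal) ↔
    (∀ a, Q a = 0 → P a = 0) ∧ ∑ a, P a * Real.logb 2 (P a / Q a) ≤ r := by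
  unfold kl
  split_ifs with h
  · exact EReal.coe_le_coe_iff.trans ⟨fun h' => ⟨h, h'⟩, And.right⟩
  · simp [h]

theorem hcReal_self {c : ℝ} (hc : 0 < c) (Q : X → ℝ) : hcReal c Q Q = 0 := by
  have h : ∀ a, mix c Q Q a = Q a := fun a => by
    unfold mix
    field_simp
  refine Finset.sum_eq_zero fun a _ => ?_
  rw [h, div_eq_zero_iff]
  left; ring

theorem hcReal_lt_of_kl_le {c : ℝ} (hc : 0 < c) {lam : ℝ} (hlam : 0 < lam) {P Q : X → ℝ}
    (hP : P ∈ stdSimplex ℝ X) (hQ : Q ∈ stdSimplex ℝ X) (h : kl P Q ≤ (lam : EReal)) :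
    hcReal c P Q < lam := by
  obtain ⟨h0, h1⟩ := kl_le_coe_iff.1 h
  rcases eq_or_ne P Q with rfl | hne
  · rwa [hcReal_self hc]
  · exact ((hcReal_le_kl hc hP hQ h0).2 hne).trans_le h1

/-- For fixed Q, finiteness is a closed support condition, and the remaining sum is continuous in P
because letters with Q a = 0 contribute zero. -/
theorem isClosed_setOf_kl_le (Q : X → ℝ) (r : ℝ) : IsClosed {P | kl P Q ≤ (r : EReal)} := by
  simp only [kl_le_coe_iff, Set.ofPred_and, Set.ofPred_forall]
  refine IsClosed.inter ?_ ?_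
  · exact isClosed_iInter fun a => isClosed_iInter fun _ =>
      isClosed_eq (continuous_apply a) continuous_const
  · refine isClosed_le (continuous_finsetSum _ fun a _ => ?_) continuous_const
    rcases eq_or_ne (Q a) 0 with h | h
    · simpa [h] using continuous_const
    · simp only [fun P : X → ℝ => mul_logb_div 2 (P a) (Q a) fun h' => absurd h' h]
      refine Continuous.div_const ?_ _
      exact (Real.continuous_mul_log.comp (continuous_apply a)).sub
        ((continuous_apply a).mul continuous_const)

theorem tendsto_rate_penalty (c k : ℝ) (hc : 0 < c) :
    Tendsto (fun n : ℕ => k * (Real.logb 2 (((n : ℝ) + 1) * (c * (n : ℝ) + 1)) / (n : ℝ)))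
      atTop (𝓝 0) := by
  have aux : ∀ d : ℝ, 0 < d →
      Tendsto (fun n : ℕ => Real.log (d * (n : ℝ) + 1) / (n : ℝ)) atTop (𝓝 0) := by
    intro d hd
    have h1 : Tendsto (fun n : ℕ => d * (n : ℝ) + 1) atTop atTop :=
      tendsto_atTop_add_const_right _ _ (tendsto_natCast_atTop_atTop.const_mul_atTop hd)
    have h2 := (Real.isLittleO_log_id_atTop.comp_tendsto h1).tendsto_div_nhds_zero
    -- With m = dn + 1, log m / n = (log m / m)(d + 1/n).
    have h3 : Tendsto (fun n : ℕ => d + 1 / (n : ℝ)) atTop (𝓝 (d + 0)) :=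
      tendsto_const_nhds.add tendsto_one_div_atTop_nhds_zero_nat
    have h4 := h2.mul h3
    rw [zero_mul] at h4
    refine h4.congr' ?_
    filter_upwards [eventually_ge_atTop 1] with n hn
    have hn' : (0 : ℝ) < n := by exact_mod_cast hn
    have : d * (n : ℝ) + 1 ≠ 0 := by positivity
    simp only [Function.comp, id]
    field_simp
  have h := (((aux 1 one_pos).add (aux c hc)).div_const (Real.log 2)).const_mul k
  simp only [add_zero, zero_div, mul_zero] at h
  refine h.congr fun n => ?_
  rw [Real.logb, Real.log_mul (by positivity) (by positivity), one_mul]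
  ring

end Information

/-! ### Types, letter counts and repetition of sequences. -/

section Empirical

/-- Indicator functions f yield total mass and marginals; f = ρ yields the cost. -/
theorem sum_mul_empirical {Y : Type*} [Fintype Y] [DecidableEq Y] {n : ℕ} (x : Fin n → Y)
    (f : Y → ℝ) : ∑ a, f a * empirical x a = (∑ i, f (x i)) / n := by
  simp only [empirical, ← mul_div_assoc]
  rw [← Finset.sum_div]
  congr 1
  rw [← Finset.sum_fiberwise (s := Finset.univ) (g := x)]
  refine Finset.sum_congr rfl fun a _ => ?_
  rw [Finset.sum_congr rfl (g := fun _ => f a) fun i hi => by rw [(Finset.mem_filter.1 hi).2],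
    Finset.sum_const, nsmul_eq_mul, mul_comm]

theorem empirical_mem_stdSimplex {Y : Type*} [Fintype Y] [DecidableEq Y] {n : ℕ} (hn : 1 ≤ n)
    (x : Fin n → Y) : empirical x ∈ stdSimplex ℝ Y := by
  refine ⟨fun a => by unfold empirical; positivity, ?_⟩
  have h := sum_mul_empirical x fun _ => (1 : ℝ)
  have hn' : (n : ℝ) ≠ 0 := by exact_mod_cast (by omega : n ≠ 0)
  simpa [hn'] using h

theorem exists_sequence_with_counts {Y : Type*} [Fintype Y] [DecidableEq Y] {n : ℕ} (k : Y → ℕ)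
    (hk : ∑ a, k a = n) :
    ∃ w : Fin n → Y, ∀ a, (Finset.univ.filter fun i => w i = a).card = k a := by
  have hcard : Fintype.card (Σ a, Fin (k a)) = n := by simp [hk]
  let e := Fintype.equivFinOfCardEq hcard
  refine ⟨fun i => (e.symm i).1, fun a => ?_⟩
  rw [← Fintype.card_subtype, Fintype.card_congr (β := {s : Σ a, Fin (k a) // s.1 = a})
    (e.symm.subtypeEquiv fun i => Iff.rfl),
    Fintype.card_congr (Equiv.sigmaSubtype a), Fintype.card_fin]

/-- Two sequences on index types of the same size with the same letter counts differ by a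
relabelling of the indices. -/
theorem exists_equiv_of_card_fiber_eq {I J Y : Type*} [Fintype I] [Fintype J] [DecidableEq Y]
    (f : I → Y) (g : J → Y) (h : ∀ a, (Finset.univ.filter fun i => f i = a).card =
      (Finset.univ.filter fun j => g j = a).card) : ∃ e : I ≃ J, ∀ i, g (e i) = f i := by
  have e : ∀ a, {i // f i = a} ≃ {j // g j = a} := fun a => by
    refine Fintype.equivOfCardEq ?_
    rw [Fintype.card_subtype, Fintype.card_subtype, h]
  exact ⟨Equiv.ofFiberEquiv e, Equiv.ofFiberEquiv_map e⟩

theorem card_filter_snd {n k : ℕ} {Y : Type*} [DecidableEq Y] (y : Fin n → Y) (a : Y) :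
    (Finset.univ.filter fun p : Fin k × Fin n => y p.2 = a).card =
      k * (Finset.univ.filter fun i => y i = a).card := by
  have : (Finset.univ.filter fun p : Fin k × Fin n => y p.2 = a) =
      Finset.univ ×ˢ (Finset.univ.filter fun i => y i = a) := by
    ext p; simp
  rw [this, Finset.card_product]; simp

theorem empirical_comp_equiv_prod {n k : ℕ} (hk : 1 ≤ k) {Y : Type*} [DecidableEq Y]
    (z : Fin n → Y) (e : Fin (k * n) ≃ Fin k × Fin n) :
    empirical (fun i => z (e i).2) = empirical z := by
  funext a
  have h : (Finset.univ.filter fun i => z (e i).2 = a).card =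
      (Finset.univ.filter fun p : Fin k × Fin n => z p.2 = a).card := by
    rw [← Fintype.card_subtype, ← Fintype.card_subtype]
    exact Fintype.card_congr (e.subtypeEquiv fun i => Iff.rfl)
  have hk' : (k : ℝ) ≠ 0 := by exact_mod_cast (by omega : k ≠ 0)
  simp only [empirical]
  rw [h, card_filter_snd, Nat.cast_mul, Nat.cast_mul, mul_div_mul_left _ _ hk']

/-- Repeating a pair of sequences: every sequence of length `k * n` with the type of `y` can be
moved to the type of `z` at `k` times the distortion between `y` and `z`. -/
theorem exists_dist_eq_of_empirical_eq {n k : ℕ} (hn : 1 ≤ n) (hk : 1 ≤ k) {Y : Type*}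
    [DecidableEq Y] (ρ : Y → Y → ℝ) (y z : Fin n → Y) (y' : Fin (k * n) → Y)
    (h : empirical y' = empirical y) :
    ∃ z' : Fin (k * n) → Y, empirical z' = empirical z ∧ dist ρ y' z' = k * dist ρ y z := by
  have hcount : ∀ a, (Finset.univ.filter fun i => y' i = a).card =
      (Finset.univ.filter fun p : Fin k × Fin n => y p.2 = a).card := fun a => by
    have ha := congrFun h a
    have hn' : (n : ℝ) ≠ 0 := by exact_mod_cast (by omega : n ≠ 0)
    have hk' : (k : ℝ) ≠ 0 := by exact_mod_cast (by omega : k ≠ 0)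
    simp only [empirical, Nat.cast_mul] at ha
    rw [card_filter_snd]
    field_simp at ha
    exact_mod_cast ha
  obtain ⟨e, he⟩ := exists_equiv_of_card_fiber_eq y' (fun p : Fin k × Fin n => y p.2) hcount
  refine ⟨fun i => z (e i).2, empirical_comp_equiv_prod hk z e, ?_⟩
  unfold dist
  simp only [← he]
  rw [e.sum_comp fun p => ρ (y p.2) (z p.2), Fintype.sum_prod_type]
  simp

end Empirical

/-! ### Joint pmfs and their approximation by joint types. -/

section Coupling

variable {X : Type*} [Fintype X]

/-- The first marginal of a joint pmf. -/
def fstMarginal (π : X × X → ℝ) : X → ℝ := fun a => ∑ b, π (a, b)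

/-- The second marginal of a joint pmf. -/
def sndMarginal (π : X × X → ℝ) : X → ℝ := fun b => ∑ a, π (a, b)

/-- The expected distortion under a joint pmf. -/
def cost (ρ : X → X → ℝ) (π : X × X → ℝ) : ℝ := ∑ p, ρ p.1 p.2 * π p

theorem continuous_fstMarginal : Continuous (fstMarginal : (X × X → ℝ) → X → ℝ) := by
  unfold fstMarginal; fun_prop

theorem continuous_sndMarginal : Continuous (sndMarginal : (X × X → ℝ) → X → ℝ) := by
  unfold sndMarginal; fun_prop

theorem continuous_cost (ρ : X → X → ℝ) : Continuous (cost ρ) := by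
  unfold cost; fun_prop

theorem fstMarginal_mem_stdSimplex {π : X × X → ℝ} (h : π ∈ stdSimplex ℝ (X × X)) :
    fstMarginal π ∈ stdSimplex ℝ X :=
  ⟨fun _ => Finset.sum_nonneg fun _ _ => h.1 _, by
    rw [← h.2, Fintype.sum_prod_type]; rfl⟩

theorem sndMarginal_mem_stdSimplex {π : X × X → ℝ} (h : π ∈ stdSimplex ℝ (X × X)) :
    sndMarginal π ∈ stdSimplex ℝ X :=
  ⟨fun _ => Finset.sum_nonneg fun _ _ => h.1 _, by
    rw [← h.2, Fintype.sum_prod_type_right]; rfl⟩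

variable [DecidableEq X]

theorem fstMarginal_empirical {n : ℕ} (w : Fin n → X × X) :
    fstMarginal (empirical w) = empirical fun i => (w i).1 := by
  funext a
  have h := sum_mul_empirical w fun p => if p.1 = a then (1 : ℝ) else 0
  rw [Fintype.sum_prod_type, Finset.sum_comm] at h
  simpa [fstMarginal, empirical] using h

theorem sndMarginal_empirical {n : ℕ} (w : Fin n → X × X) :
    sndMarginal (empirical w) = empirical fun i => (w i).2 := by
  funext a
  have h := sum_mul_empirical w fun p => if p.2 = a then (1 : ℝ) else 0
  rw [Fintype.sum_prod_type] at h
  simpa [sndMarginal, empirical] using h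

theorem cost_empirical (ρ : X → X → ℝ) {n : ℕ} (w : Fin n → X × X) :
    cost ρ (empirical w) = dist ρ (fun i => (w i).1) (fun i => (w i).2) / n :=
  sum_mul_empirical w fun p => ρ p.1 p.2

/-- The joint pmf of a pair of equal random variables. -/
def diagonal (R : X → ℝ) : X × X → ℝ := fun p => if p.1 = p.2 then R p.1 else 0

theorem fstMarginal_diagonal (R : X → ℝ) : fstMarginal (diagonal R) = R := by
  funext a; simp [fstMarginal, diagonal]

theorem sndMarginal_diagonal (R : X → ℝ) : sndMarginal (diagonal R) = R := by
  funext a; simp [sndMarginal, diagonal]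

theorem diagonal_mem_stdSimplex {R : X → ℝ} (hR : R ∈ stdSimplex ℝ X) :
    diagonal R ∈ stdSimplex ℝ (X × X) := by
  refine ⟨fun p => ?_, ?_⟩
  · unfold diagonal
    split_ifs
    exacts [hR.1 _, le_rfl]
  · rw [Fintype.sum_prod_type, ← hR.2]
    simp [diagonal]

theorem cost_diagonal {ρ : X → X → ℝ} (hρ : ∀ a, ρ a a = 0) (R : X → ℝ) :
    cost ρ (diagonal R) = 0 := by
  refine Finset.sum_eq_zero fun p _ => ?_
  unfold diagonal
  split_ifs with h
  · rw [h, hρ, zero_mul]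
  · rw [mul_zero]

omit [DecidableEq X] in
theorem cost_add_smul (ρ : X → X → ℝ) (s t : ℝ) (π σ : X × X → ℝ) :
    cost ρ (s • π + t • σ) = s * cost ρ π + t * cost ρ σ := by
  simp only [cost, Pi.add_apply, Pi.smul_apply, smul_eq_mul, mul_add, Finset.sum_add_distrib,
    Finset.mul_sum]
  congr 1 <;> exact Finset.sum_congr rfl fun _ _ => by ring

omit [DecidableEq X] in
theorem fstMarginal_add_smul (s t : ℝ) (π σ : X × X → ℝ) :
    fstMarginal (s • π + t • σ) = s • fstMarginal π + t • fstMarginal σ := by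
  funext a
  simp [fstMarginal, Finset.sum_add_distrib, Finset.mul_sum]

omit [DecidableEq X] in
theorem sndMarginal_add_smul (s t : ℝ) (π σ : X × X → ℝ) :
    sndMarginal (s • π + t • σ) = s • sndMarginal π + t • sndMarginal σ := by
  funext a
  simp [sndMarginal, Finset.sum_add_distrib, Finset.mul_sum]

/-- A joint pmf is approximated by types of pairs of sequences whose distortion is no larger: the
masses are rounded down, and what is left is put on the diagonal. -/
theorem exists_empirical_close {ρ : X → X → ℝ} (hρ_nonneg : ∀ a b, 0 ≤ ρ a b)
    (hρ_self : ∀ a, ρ a a = 0) {π : X × X → ℝ} (hπ : π ∈ stdSimplex ℝ (X × X)) {n : ℕ}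
    (hn : 1 ≤ n) (a₀ : X) :
    ∃ w : Fin n → X × X, cost ρ (empirical w) ≤ cost ρ π ∧
      ∀ p, |empirical w p - π p| ≤ Fintype.card (X × X) / n := by
  have hn' : (0 : ℝ) < n := by exact_mod_cast hn
  set f : X × X → ℕ := fun p => ⌊n * π p⌋₊ with hf
  have hf_le : ∀ p, (f p : ℝ) ≤ n * π p := fun p => Nat.floor_le (mul_nonneg hn'.le (hπ.1 p))
  have hf_lt : ∀ p, n * π p < f p + 1 := fun p => Nat.lt_floor_add_one _
  have hsum : ∑ p, n * π p = (n : ℝ) := by rw [← Finset.mul_sum, hπ.2, mul_one]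
  have hf_sum : ∑ p, f p ≤ n := by
    have : ∑ p, (f p : ℝ) ≤ n := (Finset.sum_le_sum fun p _ => hf_le p).trans_eq hsum
    exact_mod_cast this
  obtain ⟨r, hr⟩ := Nat.exists_eq_add_of_le hf_sum
  -- Each rounding down loses less than one unit, which bounds the leftover.
  have hr_le : (r : ℝ) ≤ Fintype.card (X × X) := by
    have h1 : (n : ℝ) ≤ ∑ p, ((f p : ℝ) + 1) :=
      hsum.symm.trans_le (Finset.sum_le_sum fun p _ => (hf_lt p).le)
    have h2 : (n : ℝ) = ∑ p, (f p : ℝ) + r := by exact_mod_cast hr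
    rw [Finset.sum_add_distrib, Finset.sum_const, nsmul_eq_mul, mul_one, Finset.card_univ] at h1
    linarith
  have hcard : (1 : ℝ) ≤ Fintype.card (X × X) := by
    exact_mod_cast Fintype.card_pos_iff.2 ⟨(a₀, a₀)⟩
  obtain ⟨w, hw⟩ := exists_sequence_with_counts (n := n)
    (fun p => f p + if p = (a₀, a₀) then r else 0) (by
      rw [Finset.sum_add_distrib, Finset.sum_ite_eq' Finset.univ]; simp [← hr])
  have hemp : ∀ p, empirical w p = (f p + if p = (a₀, a₀) then (r : ℝ) else 0) / n := fun p => by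
    rw [empirical, hw]; push_cast; rfl
  refine ⟨w, Finset.sum_le_sum fun p _ => ?_, fun p => ?_⟩
  · rw [hemp]
    split_ifs with h
    · simp [h, hρ_self]
    · refine mul_le_mul_of_nonneg_left ?_ (hρ_nonneg _ _)
      rw [add_zero, div_le_iff₀ hn', mul_comm]
      exact hf_le p
  · have e : empirical w p - π p =
        (f p + (if p = (a₀, a₀) then (r : ℝ) else 0) - n * π p) / n := by
      rw [hemp]; field_simp
    rw [e, abs_div, abs_of_pos hn']
    refine div_le_div_of_nonneg_right (abs_le.2 ?_) hn'.le
    have h1 := hf_le p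
    have h2 := hf_lt p
    have h3 : (0 : ℝ) ≤ r := r.cast_nonneg
    split_ifs <;> constructor <;> linarith

end Coupling

/-! ### Movable types, their closure, and relative openness. -/

section Regions

variable {X : Type*} [Fintype X]

/-- The joint pmfs with expected distortion at most `D` whose second marginal lies in `A`. -/
def couplings (ρ : X → X → ℝ) (D : ℝ) (A : Set (X → ℝ)) : Set (X × X → ℝ) :=
  {π | π ∈ stdSimplex ℝ (X × X) ∧ cost ρ π ≤ D ∧ sndMarginal π ∈ A}

theorem isCompact_couplings (ρ : X → X → ℝ) (D : ℝ) {A : Set (X → ℝ)} (hA : IsClosed A) :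
    IsCompact (couplings ρ D A) :=
  (isCompact_stdSimplex ℝ (X × X)).inter_right
    ((isClosed_le (continuous_cost ρ) continuous_const).inter (hA.preimage continuous_sndMarginal))

variable [DecidableEq X]

/-- The types of the sequences that can be moved, with per-letter distortion at most `D`, to a
sequence whose type lies in `A`. -/
def movable (ρ : X → X → ℝ) (D : ℝ) (A : Set (X → ℝ)) : Set (X → ℝ) :=
  {P | ∃ n : ℕ, 1 ≤ n ∧ ∃ y z : Fin n → X,
    empirical y = P ∧ dist ρ y z ≤ n * D ∧ empirical z ∈ A}

theorem movable_subset_stdSimplex (ρ : X → X → ℝ) (D : ℝ) (A : Set (X → ℝ)) :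
    movable ρ D A ⊆ stdSimplex ℝ X := by
  rintro _ ⟨n, hn, y, z, rfl, -, -⟩
  exact empirical_mem_stdSimplex hn y

theorem movable_subset_fstMarginal_image (ρ : X → X → ℝ) (D : ℝ) (A : Set (X → ℝ)) :
    movable ρ D A ⊆ fstMarginal '' couplings ρ D A := by
  rintro _ ⟨n, hn, y, z, rfl, hd, hz⟩
  have hn' : (0 : ℝ) < n := by exact_mod_cast hn
  refine ⟨empirical fun i => (y i, z i), ⟨empirical_mem_stdSimplex hn _, ?_, ?_⟩, ?_⟩
  · rw [cost_empirical, div_le_iff₀ hn', mul_comm]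
    exact hd
  · rwa [sndMarginal_empirical]
  · rw [fstMarginal_empirical]

theorem closure_movable_subset (ρ : X → X → ℝ) (D : ℝ) {A : Set (X → ℝ)} (hA : IsClosed A) :
    closure (movable ρ D A) ⊆ fstMarginal '' couplings ρ D A :=
  closure_minimal (movable_subset_fstMarginal_image ρ D A)
    ((isCompact_couplings ρ D hA).image continuous_fstMarginal).isClosed

/-- The rounding never raises the cost, so the bound D needs no slack; openness of A absorbs the
perturbation of the second marginal. -/
theorem fstMarginal_mem_closure_movable {ρ : X → X → ℝ} (hρ_nonneg : ∀ a b, 0 ≤ ρ a b)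
    (hρ_self : ∀ a, ρ a a = 0) {D : ℝ} {A : Set (X → ℝ)} (hA : IsOpen A) {π : X × X → ℝ}
    (hπ : π ∈ couplings ρ D A) : fstMarginal π ∈ closure (movable ρ D A) := by
  obtain ⟨hs, hcost, hsnd⟩ := hπ
  have hne : Nonempty X := by
    by_contra h
    rw [not_nonempty_iff] at h
    simpa using hs.2
  obtain ⟨a₀⟩ := hne
  choose w hw_cost hw_close using fun n : ℕ =>
    exists_empirical_close hρ_nonneg hρ_self hs (Nat.le_add_left 1 n) a₀
  have hlim : Tendsto (fun n => empirical (w n)) atTop (𝓝 π) := by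
    refine tendsto_pi_nhds.2 fun p => ?_
    rw [tendsto_iff_dist_tendsto_zero]
    refine squeeze_zero (fun _ => dist_nonneg) (fun n => hw_close n p) ?_
    exact (tendsto_const_div_atTop_nhds_zero_nat _).comp (tendsto_add_atTop_nat 1)
  refine mem_closure_of_tendsto ((continuous_fstMarginal.tendsto π).comp hlim) ?_
  filter_upwards [((continuous_sndMarginal.tendsto π).comp hlim).eventually (hA.mem_nhds hsnd)]
    with n hn
  have hn' : (0 : ℝ) < ((n + 1 : ℕ) : ℝ) := by positivity
  refine ⟨n + 1, Nat.le_add_left 1 n, fun i => (w n i).1, fun i => (w n i).2,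
    (fstMarginal_empirical (w n)).symm, ?_, ?_⟩
  · have h := (hw_cost n).trans hcost
    rwa [cost_empirical, div_le_iff₀ hn', mul_comm] at h
  · rw [← sndMarginal_empirical]
    exact hn

omit [DecidableEq X] in
/-- Every pmf `P'` near a pmf `P` is `(1 - ε) P + ε R` for a pmf `R`. -/
theorem eventually_exists_mixture {P : X → ℝ} (hP : P ∈ stdSimplex ℝ X) {ε : ℝ} (hε : 0 < ε) :
    ∀ᶠ P' in 𝓝[stdSimplex ℝ X] P, ∃ R ∈ stdSimplex ℝ X, P' = (1 - ε) • P + ε • R := by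
  have h : ∀ a, ∀ᶠ P' in 𝓝[stdSimplex ℝ X] P, (1 - ε) * P a ≤ P' a := by
    intro a
    -- Off the support of P the bound is mere nonnegativity, which is why the neighbourhood is taken
    -- within the simplex; on the support it is strict at P.
    rcases (hP.1 a).eq_or_lt with h0 | h0
    · filter_upwards [self_mem_nhdsWithin] with P' hP'
      rw [← h0, mul_zero]
      exact hP'.1 a
    · have hlt : (1 - ε) * P a < P a := by nlinarith
      exact mem_nhdsWithin_of_mem_nhds
        (((continuous_apply a).tendsto P).eventually_const_le hlt)
  filter_upwards [eventually_all.2 h, self_mem_nhdsWithin] with P' hle hP'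
  refine ⟨fun a => (P' a - (1 - ε) * P a) / ε,
    ⟨fun a => div_nonneg (sub_nonneg.2 (hle a)) hε.le, ?_⟩, ?_⟩
  · rw [← Finset.sum_div, Finset.sum_sub_distrib, ← Finset.mul_sum, hP.2, hP'.2]
    field_simp
    ring
  · funext a
    simp only [Pi.add_apply, Pi.smul_apply, smul_eq_mul]
    field_simp
    ring

/-- The pmfs that can be moved into an open set `A` form a relatively open set. -/
theorem fstMarginal_image_couplings_mem_nhdsWithin {ρ : X → X → ℝ} (hρ_self : ∀ a, ρ a a = 0)
    {D : ℝ} (hD : 0 ≤ D) {A : Set (X → ℝ)} (hA : IsOpen A) {π : X × X → ℝ}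
    (hπ : π ∈ couplings ρ D A) :
    fstMarginal '' couplings ρ D A ∈ 𝓝[stdSimplex ℝ X] (fstMarginal π) := by
  obtain ⟨hs, hcost, hsnd⟩ := hπ
  -- a uniform `ε` for all `R`, by compactness of the simplex
  obtain ⟨ε, hε0, hε1, hε⟩ : ∃ ε : ℝ, 0 < ε ∧ ε ≤ 1 ∧ ∀ R ∈ stdSimplex ℝ X,
      (1 - ε) • sndMarginal π + ε • R ∈ A := by
    have hcont : Continuous fun q : ℝ × (X → ℝ) => (1 - q.1) • sndMarginal π + q.1 • q.2 := by
      fun_prop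
    have hev : ∀ᶠ ε : ℝ in 𝓝 0, ∀ R ∈ stdSimplex ℝ X, (1 - ε) • sndMarginal π + ε • R ∈ A := by
      refine (isCompact_stdSimplex ℝ X).eventually_forall_of_forall_eventually fun R _ => ?_
      refine hcont.continuousAt.eventually (hA.mem_nhds ?_)
      simpa using hsnd
    have hev' : ∀ᶠ ε : ℝ in 𝓝[>] 0, ∀ R ∈ stdSimplex ℝ X,
        (1 - ε) • sndMarginal π + ε • R ∈ A := hev.filter_mono nhdsWithin_le_nhds
    obtain ⟨ε, h1, h2⟩ := (hev'.and (Ioc_mem_nhdsGT one_pos)).exists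
    exact ⟨ε, h2.1, h2.2, h1⟩
  filter_upwards [eventually_exists_mixture (fstMarginal_mem_stdSimplex hs) hε0]
  rintro _ ⟨R, hR, rfl⟩
  -- The R part stays in place at no cost, so the cost is at most (1 − ε)D ≤ D.
  refine ⟨(1 - ε) • π + ε • diagonal R, ⟨?_, ?_, ?_⟩, ?_⟩
  · exact convex_stdSimplex ℝ _ hs (diagonal_mem_stdSimplex hR) (sub_nonneg.2 hε1) hε0.le
      (sub_add_cancel _ _)
  · rw [cost_add_smul, cost_diagonal hρ_self, mul_zero, add_zero]
    nlinarith [mul_le_mul_of_nonneg_left hcost (sub_nonneg.2 hε1)]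
  · rw [sndMarginal_add_smul, sndMarginal_diagonal]
    exact hε R hR
  · rw [fstMarginal_add_smul, fstMarginal_diagonal]

theorem gammaKS_subset_movable (ρ : X → X → ℝ) (D lam : ℝ) {n : ℕ} (hn : 1 ≤ n) (PX : X → ℝ) :
    gammaKS ρ D lam n PX ⊆ movable ρ D {P | kl P PX ≤ (lam : EReal)} := by
  rintro _ ⟨⟨y, rfl⟩, h⟩
  obtain ⟨z, ⟨-, hz⟩, hd⟩ := h y rfl
  refine ⟨n, hn, y, z, rfl, hd, hz.le.trans (EReal.coe_le_coe_iff.2 ?_)⟩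
  have : 0 ≤ Real.logb 2 ((n : ℝ) + 1) :=
    Real.logb_nonneg one_lt_two (by linarith [n.cast_nonneg (α := ℝ)])
  linarith [show 0 ≤ (Fintype.card X : ℝ) * (Real.logb 2 ((n : ℝ) + 1) / (n : ℝ)) by positivity]

/-- A k-fold repetition preserves types and per-letter distortion while the penalty at length kn
tends to 0. One movable sequence suffices, since all sequences of its type are rearrangements of it.
-/
theorem movable_subset_iUnion_gammaTR (ρ : X → X → ℝ) (D : ℝ) {c : ℝ} (hc : 0 < c) (lam : ℝ)
    {PX : X → ℝ} (hPX : PX ∈ stdSimplex ℝ X) :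
    movable ρ D {P | hcReal c P PX < lam} ⊆
      ⋃ (n : ℕ) (_ : 1 ≤ n), gammaTR ρ D c lam n PX := by
  rintro _ ⟨n, hn, y, z, rfl, hd, hz⟩
  have hlim : Tendsto (fun k : ℕ => k * n) atTop atTop :=
    tendsto_id.atTop_mul_const' (by omega)
  have hpen := ((tendsto_rate_penalty c (Fintype.card X) hc).comp hlim).eventually_lt_const
    (sub_pos.2 hz)
  obtain ⟨k, hk, hk1⟩ := (hpen.and (eventually_ge_atTop 1)).exists
  have hkn : 1 ≤ k * n := Nat.mul_pos hk1 hn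
  have hmem : ∀ {m : ℕ}, 1 ≤ m → ∀ x : Fin m → X, ∃ x' : Fin (k * m) → X,
      empirical x' = empirical x := fun {m} _ x =>
    ⟨_, empirical_comp_equiv_prod hk1 x finProdFinEquiv.symm⟩
  refine Set.mem_iUnion₂.2 ⟨k * n, hkn, hmem hn y, fun y' hy' => ?_⟩
  obtain ⟨z', hz', hd'⟩ := exists_dist_eq_of_empirical_eq hn hk1 ρ y z y' hy'
  refine ⟨z', ⟨⟨z', rfl⟩, ?_⟩, ?_⟩
  · change HypTest.hc c (empirical z') PX < _
    rw [hz', hc_eq_coe_hcReal hc (empirical_mem_stdSimplex hn z).1 hPX.1, EReal.coe_lt_coe_iff]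
    have hk2 := hk
    simp only [Function.comp] at hk2
    linarith
  · rw [hd', Nat.cast_mul, mul_assoc]
    exact mul_le_mul_of_nonneg_left hd k.cast_nonneg

end Regions

end HypTest

/-! ### Inclusion, and strictness by connectedness. -/

theorem theorem5 {X : Type*} [Fintype X] [DecidableEq X]
    (ρ : X → X → ℝ) (hρ_nonneg : ∀ a b, 0 ≤ ρ a b) (hρ_self : ∀ a, ρ a a = 0)
    (D : ℝ) (hD : 0 ≤ D) (c : ℝ) (hc : 0 < c) (lam : ℝ) (hlam : 0 < lam)
    (PX : X → ℝ) (hPX : PX ∈ stdSimplex ℝ X) :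
    HypTest.gammaKSInf ρ D lam PX ⊆ HypTest.gammaTRInf ρ D c lam PX ∧
    (HypTest.gammaKSInf ρ D lam PX ≠ stdSimplex ℝ X →
      HypTest.gammaKSInf ρ D lam PX ⊂ HypTest.gammaTRInf ρ D c lam PX) := by
  open HypTest in
  have hKS : (⋃ (n : ℕ) (_ : 1 ≤ n), gammaKS ρ D lam n PX) ⊆
      movable ρ D {P | kl P PX ≤ (lam : EReal)} :=
    Set.iUnion₂_subset fun n hn => gammaKS_subset_movable ρ D lam hn PX
  have hTR := movable_subset_iUnion_gammaTR ρ D hc lam hPX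
  have hmov : movable ρ D {P | kl P PX ≤ (lam : EReal)} ⊆
      movable ρ D {P | hcReal c P PX < lam} := by
    rintro _ ⟨n, hn, y, z, rfl, hd, hz⟩
    exact ⟨n, hn, y, z, rfl, hd,
      hcReal_lt_of_kl_le hc hlam (empirical_mem_stdSimplex hn z) hPX hz⟩
  have hopen : IsOpen {P | hcReal c P PX < lam} :=
    isOpen_lt (continuous_hcReal c PX) continuous_const
  have himage : fstMarginal '' couplings ρ D {P | hcReal c P PX < lam} ⊆
      gammaTRInf ρ D c lam PX := by
    rintro _ ⟨π, hπ, rfl⟩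
    exact closure_mono hTR (fstMarginal_mem_closure_movable hρ_nonneg hρ_self hopen hπ)
  have hsub : gammaKSInf ρ D lam PX ⊆ gammaTRInf ρ D c lam PX :=
    closure_mono (hKS.trans (hmov.trans hTR))
  refine ⟨hsub, fun hne => hsub.ssubset_of_not_subset fun hle => hne ?_⟩
  have hsimplex : gammaKSInf ρ D lam PX ⊆ stdSimplex ℝ X :=
    closure_minimal (hKS.trans (movable_subset_stdSimplex ρ D _)) (isClosed_stdSimplex ℝ X)
  refine hsimplex.antisymm fun P hP => ?_
  have : PreconnectedSpace (stdSimplex ℝ X) :=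
    isPreconnected_iff_preconnectedSpace.1 (convex_stdSimplex ℝ X).isPreconnected
  have hclopen : IsClopen ((↑) ⁻¹' gammaKSInf ρ D lam PX : Set (stdSimplex ℝ X)) := by
    refine ⟨isClosed_closure.preimage continuous_subtype_val, isOpen_iff_mem_nhds.2 ?_⟩
    rintro ⟨Q, hQs⟩ hQ
    obtain ⟨π, ⟨hs, hcost, hkl⟩, rfl⟩ :=
      closure_movable_subset ρ D (isClosed_setOf_kl_le PX lam) (closure_mono hKS hQ)
    have hnhds := fstMarginal_image_couplings_mem_nhdsWithin hρ_self hD hopen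
      ⟨hs, hcost, hcReal_lt_of_kl_le hc hlam (sndMarginal_mem_stdSimplex hs) hPX hkl⟩
    -- Only here and for `PX` below is the assumed reverse inclusion `hle` needed: it returns the
    -- neighbourhood to the known-source region.
    exact preimage_coe_mem_nhds_subtype.2 (mem_of_superset hnhds (himage.trans hle))
  have hmem : PX ∈ gammaKSInf ρ D lam PX := by
    refine hle (himage ⟨diagonal PX, ⟨diagonal_mem_stdSimplex hPX, ?_, ?_⟩,
      fstMarginal_diagonal PX⟩)
    · rwa [cost_diagonal hρ_self]
    · rw [sndMarginal_diagonal]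
      exact (hcReal_self hc PX).trans_lt hlam
  have huniv := hclopen.eq_univ ⟨⟨PX, hPX⟩, hmem⟩
  exact (Set.eq_univ_iff_forall.1 huniv ⟨P, hP⟩ :)
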